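/- Let $k$ be a field of characteristic $0$ and let $n_0, n_1$ be positive integers with $n_0 < n_1$ and $\gcd(n_0,n_1)=1$. Let \[ S = \langle (0,n_1),\ (n_0,n_1-n_0),\ (n_1,0)\rangle \subseteq \mathbb{N}^2 \] be the submonoid generated by these three elements (where $\mathbb N$ contains $0$), let $S_1, S_2\subseteq \mathbb{N}$ be its projections to the first and second component, and let $k[S]=\bigoplus_{(a,b)\in S} k\,t^a u^b \subseteq k[t,u]$ be its semigroup ring. Let $\mathrm{Der}_k(k[S])$ be the $k[S]$-module of $k$-derivations $k[S]\to k[S]$. Then the derivations of $k[t,u]$ listed below map $k[S]$ into itself, and their restrictions to $k[S]$ minimally generate $\mathrm{Der}_k(k[S])$; that is, they generate it, they are distinct, no proper subset of them generates it, and no generating set has fewer than four elements. 1. If $S_1\neq\mathbb{N}$ and $S_2 \neq \mathbb{N}$: \[ t \frac{\partial}{\partial t},\quad t^{n_0(n_1-1)-n_1+1}u^{(n_1-1)(n_1-n_0)}\frac{\partial}{\partial t},\quad u \frac{\partial}{\partial u},\quad t^{n_0(n_1-1)}u^{(n_1-1)(n_1-n_0)-n_1+1}\frac{\partial}{\partial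 u}. \] 2. If $S_1 = \mathbb{N}$ and $S_2 \neq \mathbb{N}$: \[ t \frac{\partial}{\partial t},\quad u^{1+(n_1-2)n_1}\frac{\partial}{\partial t},\quad u \frac{\partial}{\partial u},\quad t^{n_1-1}u^{(n_1-1)(n_1-2)}\frac{\partial}{\partial u}. \] 3. If $S_1 \neq \mathbb{N}$ and $S_2 = \mathbb{N}$: \[ t \frac{\partial}{\partial t},\quad t^{n_0(n_1-1)-n_1+1}u^{n_1-1}\frac{\partial}{\partial t},\quad u \frac{\partial}{\partial u},\quad t^{n_0(n_1-1)}\frac{\partial}{\partial u}. \] 4. If $S_1 = S_2 = \mathbb{N}$: \[ t \frac{\partial}{\partial t},\quad u\frac{\partial}{\partial t},\quad u \frac{\partial}{\partial u},\quad t\frac{\partial}{\partial u}. \] -/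

import Mathlib

/-- The affine semigroup `⟨(0, n₁), (n₀, n₁ - n₀), (n₁, 0)⟩` in `ℕ²`
(used only for `n₀ < n₁`, so the subtraction is the true one). -/
def curveSemigroup (n₀ n₁ : ℕ) : AddSubmonoid (ℕ × ℕ) :=
  AddSubmonoid.closure {(0, n₁), (n₀, n₁ - n₀), (n₁, 0)}

/-- The natural projection of a subsemigroup of `ℕ²` to the first component. -/
def firstProjection (S : AddSubmonoid (ℕ × ℕ)) : AddSubmonoid ℕ :=
  S.map (AddMonoidHom.fst ℕ ℕ)

/-- The natural projection of a subsemigroup of `ℕ²` to the second component. -/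
def secondProjection (S : AddSubmonoid (ℕ × ℕ)) : AddSubmonoid ℕ :=
  S.map (AddMonoidHom.snd ℕ ℕ)

/-- The monomial `t ^ a * u ^ b` of `k[t, u]`, where `t = X 0` and `u = X 1`. -/
noncomputable def tuMonomial (k : Type*) [Field k] (a b : ℕ) : MvPolynomial (Fin 2) k :=
  MvPolynomial.X 0 ^ a * MvPolynomial.X 1 ^ b

/-- The semigroup ring `k[S]`, the subalgebra of `k[t, u]` generated (equivalently, since `S` is
closed under addition and contains `0`, spanned over `k`) by the `t ^ a * u ^ b`, `(a, b) ∈ S`. -/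
noncomputable def semigroupRing (k : Type*) [Field k] (S : AddSubmonoid (ℕ × ℕ)) :
    Subalgebra k (MvPolynomial (Fin 2) k) :=
  Algebra.adjoin k ((fun s : ℕ × ℕ => tuMonomial k s.1 s.2) '' (S : Set (ℕ × ℕ)))

/-- The derivation `t ^ a * u ^ b * ∂/∂t` of `k[t, u]`. -/
noncomputable def monDt (k : Type*) [Field k] (a b : ℕ) :
    Derivation k (MvPolynomial (Fin 2) k) (MvPolynomial (Fin 2) k) :=
  tuMonomial k a b • MvPolynomial.pderiv 0

/-- The derivation `t ^ a * u ^ b * ∂/∂u` of `k[t, u]`. -/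
noncomputable def monDu (k : Type*) [Field k] (a b : ℕ) :
    Derivation k (MvPolynomial (Fin 2) k) (MvPolynomial (Fin 2) k) :=
  tuMonomial k a b • MvPolynomial.pderiv 1

/-- The finite family `v` minimally generates the `R`-module `M`: it generates `M`, no proper
subfamily generates `M` (in particular the members of `v` are distinct), and no generating set of
`M` has fewer elements. -/
structure IsMinimalGeneratingFamily (R : Type*) {M : Type*} [CommRing R] [AddCommGroup M]
    [Module R M] {n : ℕ} (v : Fin n → M) : Prop where
  span_eq_top : Submodule.span R (Set.range v) = ⊤
  irredundant : ∀ J : Set (Fin n), J ≠ Set.univ → Submodule.span R (v '' J) ≠ ⊤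
  card_le : ∀ Y : Set M, Submodule.span R Y = ⊤ → (n : ℕ∞) ≤ Y.encard

/-- The `k`-derivations `D i` of the commutative `k`-algebra `A` minimally generate the `A`-module
`Der_k(A)` of all `k`-derivations `A → A`. -/
def DerMinimallyGenerates (k A : Type*) [Field k] [CommRing A] [Algebra k A] {n : ℕ}
    (D : Fin n → Derivation k A A) : Prop :=
  IsMinimalGeneratingFamily A D

/-- The derivations `E i` of `k[t, u]` map the subalgebra `A` into itself, and their restrictions
to `A` (the derivations `D i`, which are determined by the `E i`) minimally generate the
`A`-module `Der_k(A)`. -/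
def DerMinimallyGeneratedBy {k : Type*} [Field k] (A : Subalgebra k (MvPolynomial (Fin 2) k))
    {n : ℕ} (E : Fin n → Derivation k (MvPolynomial (Fin 2) k) (MvPolynomial (Fin 2) k)) : Prop :=
  ∃ D : Fin n → Derivation k A A,
    (∀ (i : Fin n) (f : A), ((D i f : A) : MvPolynomial (Fin 2) k) = E i f) ∧
    DerMinimallyGenerates k A D

/-! Write `p = n₀`, `n = n₁`, `X = t^n`, `Y = u^n`, `Z = t^p u^(n-p)`, so that `k[S] = k[X, Y, Z]`
with `Z^n = X^p Y^(n-p)`. Differentiating this relation shows that a derivation `F` is determined by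
`F X` and `F Y`, and that `Z Y (F X)` is a multiple of `X`. As `p` and `n` are coprime, comparing
monomials gives `F X ∈ (X, Z^(n-1))` (`exists_eq_curveX_mul_add`), and symmetrically `F Y ∈ (Y,
Z^(n-1))`. The four listed derivations take `(X, Y)` to `n` times `(X, 0)`, `(Z^(n-1), 0)`, `(0,
Y)`, `(0, Z^(n-1))`, hence generate. In any relation among them all coefficients have zero constant
term, because `X` and `Y` do not divide `Z^(n-1)` in `k[S]`;
`isMinimalGeneratingFamily_of_augmentation` turns this into minimality. The four cases of the
theorem are one formula in `p` and `n`, simplified when `p = 1` or `n - p = 1`. -/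

open MvPolynomial

/-! ### Minimality of a generating family via an augmentation -/

theorem isMinimalGeneratingFamily_of_augmentation {R K M : Type*} [CommRing R] [Field K]
    [AddCommGroup M] [Module R M] {n : ℕ} (v : Fin n → M) (ε : R →+* K)
    (hspan : Submodule.span R (Set.range v) = ⊤)
    (hrel : ∀ f : Fin n → R, ∑ i, f i • v i = 0 → ∀ i, ε (f i) = 0) :
    IsMinimalGeneratingFamily R v := by
  have hcard : ∀ Y : Set M, Submodule.span R Y = ⊤ → (n : ℕ∞) ≤ Y.encard := by
    intro Y hY
    by_contra! hlt
    have hfin : Y.Finite := Set.finite_of_encard_le_coe hlt.le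
    have hex : ∀ m : M, ∃ g : Fin n → R, ∑ i, g i • v i = m := fun m =>
      (Submodule.mem_span_range_iff_exists_fun R).1 (hspan ▸ Submodule.mem_top)
    choose g hg using hex
    have huniq : ∀ g₁ g₂ : Fin n → R, ∑ i, g₁ i • v i = ∑ i, g₂ i • v i →
        (fun i => ε (g₁ i)) = fun i => ε (g₂ i) := by
      intro g₁ g₂ h
      funext i
      have := hrel (fun i => g₁ i - g₂ i) (by simp [sub_smul, h]) i
      rwa [map_sub, sub_eq_zero] at this
    -- By `huniq`, the coefficients modulo `ker ε` do not depend on the choice of `g`. So `w` is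
    -- additive and semilinear along `ε`, and it carries a generating set of `M` to a spanning set
    -- of `K^n`.
    let w : M → Fin n → K := fun m i => ε (g m i)
    have hw : ∀ m, w m ∈ Submodule.span K (w '' Y) := by
      intro m
      have hm : m ∈ Submodule.span R Y := hY ▸ Submodule.mem_top
      induction hm using Submodule.span_induction with
      | mem x hx => exact Submodule.subset_span ⟨x, hx, rfl⟩
      | zero =>
        have : w 0 = 0 := by
          have := huniq (g 0) 0 (by simp [hg])
          simpa [w, funext_iff] using this
        rw [this]; exact zero_mem _
      | add x y _ _ hx hy =>
        have : w (x + y) = w x + w y := by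
          have := huniq (g (x + y)) (g x + g y) (by simp [hg, add_smul, Finset.sum_add_distrib])
          simpa [w, funext_iff] using this
        rw [this]; exact add_mem hx hy
      | smul a x _ hx =>
        have : w (a • x) = ε a • w x := by
          have := huniq (g (a • x)) (a • g x) (by simp [hg, mul_smul, ← Finset.smul_sum])
          simpa [w, funext_iff] using this
        rw [this]; exact Submodule.smul_mem _ _ hx
    have htop : Submodule.span K (w '' Y) = ⊤ := by
      rw [eq_top_iff, ← (Pi.basisFun K (Fin n)).span_eq, Submodule.span_le]
      rintro _ ⟨i, rfl⟩
      have := huniq (g (v i)) (Pi.single i 1) (by simp [hg, Pi.single_apply])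
      have h2 : (Pi.basisFun K (Fin n)) i = w (v i) := by
        funext j
        have := congrFun this j
        simp only [w, this, Pi.basisFun_apply, Pi.single_apply]
        split_ifs <;> simp
      rw [SetLike.mem_coe, h2]
      exact hw _
    have hle : (n : Cardinal) ≤ Cardinal.mk (w '' Y) := by
      have := rank_span_le (R := K) (w '' Y)
      rw [htop, rank_top] at this
      simpa using this
    have hle2 : (n : ℕ∞) ≤ (w '' Y).encard := by
      rw [Set.encard, ENat.card]
      exact Cardinal.natCast_le_toENat.2 hle
    exact absurd (hle2.trans (Set.encard_image_le _ _)) (not_le.2 hlt)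
  -- Irredundance follows from the cardinality bound: a proper subfamily has fewer than `n` members.
  refine ⟨hspan, fun J hJ hJs => ?_, hcard⟩
  have h1 := (hcard _ hJs).trans (Set.encard_image_le _ _)
  have h2 : J.encard < (Set.univ : Set (Fin n)).encard :=
    (Set.toFinite J).encard_lt_encard (Set.ssubset_univ_iff.2 hJ)
  rw [Set.encard_univ, ENat.card_eq_coe_fintype_card, Fintype.card_fin] at h2
  exact absurd h1 (not_le.2 h2)

/-! ### Arithmetic of the semigroup -/

theorem mem_curveSemigroup {p n : ℕ} {s : ℕ × ℕ} :
    s ∈ curveSemigroup p n ↔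
      ∃ a b c : ℕ, s = (b * p + c * n, a * n + b * (n - p)) := by
  constructor
  · intro hs
    induction hs using AddSubmonoid.closure_induction with
    | mem x hx =>
      rcases hx with rfl | rfl | rfl
      · exact ⟨1, 0, 0, by simp⟩
      · exact ⟨0, 1, 0, by simp⟩
      · exact ⟨0, 0, 1, by simp⟩
    | zero => exact ⟨0, 0, 0, by simp; rfl⟩
    | add x y _ _ hx hy =>
      obtain ⟨a, b, c, rfl⟩ := hx
      obtain ⟨a', b', c', rfl⟩ := hy
      refine ⟨a + a', b + b', c + c', ?_⟩
      ext <;> simp <;> ring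
  · rintro ⟨a, b, c, rfl⟩
    have h : ((b * p + c * n, a * n + b * (n - p)) : ℕ × ℕ) =
        a • (0, n) + b • (p, n - p) + c • (n, 0) := by
      ext <;> simp
    rw [h]
    refine add_mem (add_mem (nsmul_mem ?_ a) (nsmul_mem ?_ b)) (nsmul_mem ?_ c) <;>
      exact AddSubmonoid.subset_closure (by simp)

/-- Equality would give `(B - b) p = (c + 1) n`, so `n` divides `B - b < n`, forcing `B = b` against
the positivity of `(c + 1) n`. All uses of coprimality pass through this. -/
theorem mul_ne_mul_add_succ_mul {p n B b c : ℕ} (hcop : Nat.Coprime p n)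
    (hB : B < n) : B * p ≠ b * p + (c + 1) * n := by
  intro h
  have hle : b ≤ B := by
    by_contra! hlt
    have := Nat.mul_le_mul_right p hlt.le
    have : 0 < (c + 1) * n := Nat.mul_pos c.succ_pos (by omega)
    omega
  obtain ⟨d, rfl⟩ := Nat.exists_eq_add_of_le hle
  have h1 : d * p = (c + 1) * n := by linarith [add_mul b d p]
  have h2 : n ∣ d := hcop.symm.dvd_of_dvd_mul_right (h1 ▸ Dvd.intro_left _ rfl)
  rcases Nat.eq_zero_or_pos d with rfl | hd
  · have : 0 < (c + 1) * n := Nat.mul_pos c.succ_pos (by omega)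
    omega
  · have := Nat.le_of_dvd hd h2
    omega

/-! ### Monomials of `k[t, u]` and supports of elements of `k[S]` -/

section Monomials

variable {k : Type*} [Field k]

theorem tuMonomial_eq_monomial (a b : ℕ) :
    tuMonomial k a b = monomial (Finsupp.single 0 a + Finsupp.single 1 b) (1 : k) := by
  rw [tuMonomial, X_pow_eq_monomial, X_pow_eq_monomial, monomial_mul, one_mul]

theorem tuMonomial_mul (a b c d : ℕ) :
    tuMonomial k a b * tuMonomial k c d = tuMonomial k (a + c) (b + d) := by
  simp only [tuMonomial]; ring

theorem tuMonomial_pow (a b m : ℕ) :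
    tuMonomial k a b ^ m = tuMonomial k (m * a) (m * b) := by
  simp only [tuMonomial, mul_pow, ← pow_mul, mul_comm]

theorem tuMonomial_ne_zero (a b : ℕ) : tuMonomial k a b ≠ 0 := by
  rw [tuMonomial_eq_monomial]; simp

theorem single_add_single_fin_two (d : Fin 2 →₀ ℕ) :
    Finsupp.single 0 (d 0) + Finsupp.single 1 (d 1) = d := by
  ext i; fin_cases i <;> simp

theorem monomial_eq_C_mul_tuMonomial (d : Fin 2 →₀ ℕ) (c : k) :
    monomial d c = C c * tuMonomial k (d 0) (d 1) := by
  rw [tuMonomial_eq_monomial, single_add_single_fin_two, C_mul_monomial, mul_one]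

theorem single_add_single_le_iff (a b : ℕ) (d : Fin 2 →₀ ℕ) :
    Finsupp.single 0 a + Finsupp.single 1 b ≤ d ↔ a ≤ d 0 ∧ b ≤ d 1 := by
  constructor
  · intro h
    exact ⟨by simpa using h 0, by simpa using h 1⟩
  · rintro ⟨h0, h1⟩ i
    fin_cases i <;> simpa

theorem coeff_tuMonomial_mul (a b : ℕ) (d : Fin 2 →₀ ℕ) (f : MvPolynomial (Fin 2) k) :
    coeff d (tuMonomial k a b * f) =
      if a ≤ d 0 ∧ b ≤ d 1 then
        coeff (d - (Finsupp.single 0 a + Finsupp.single 1 b)) f else 0 := by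
  classical
  rw [tuMonomial_eq_monomial, coeff_monomial_mul']
  simp only [single_add_single_le_iff, one_mul]

theorem tuMonomial_mem_semigroupRing {S : AddSubmonoid (ℕ × ℕ)} {a b : ℕ} (h : (a, b) ∈ S) :
    tuMonomial k a b ∈ semigroupRing k S :=
  Algebra.subset_adjoin ⟨(a, b), h, rfl⟩

theorem mem_of_mem_support_of_mem_semigroupRing {S : AddSubmonoid (ℕ × ℕ)}
    {f : MvPolynomial (Fin 2) k} (hf : f ∈ semigroupRing k S) :
    ∀ d ∈ f.support, (d 0, d 1) ∈ S := by
  classical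
  induction hf using Algebra.adjoin_induction with
  | mem x hx =>
    obtain ⟨s, hs, rfl⟩ := hx
    intro d hd
    simp only [tuMonomial_eq_monomial] at hd
    have := support_monomial_subset hd
    rw [Finset.mem_singleton] at this
    subst this
    simpa using hs
  | algebraMap r =>
    intro d hd
    rw [algebraMap_eq, C_apply] at hd
    have := support_monomial_subset hd
    rw [Finset.mem_singleton] at this
    subst this
    exact S.zero_mem
  | add x y _ _ hx hy =>
    intro d hd
    rcases Finset.mem_union.1 (support_add hd) with h | h
    exacts [hx d h, hy d h]
  | mul x y _ _ hx hy =>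
    intro d hd
    obtain ⟨d₁, h₁, d₂, h₂, rfl⟩ := Finset.mem_add.1 (support_mul x y hd)
    exact S.add_mem (hx d₁ h₁) (hy d₂ h₂)

/-- If `x ^ w * g` is divisible by `x ^ e` in `k[S]`, then `g` lies in the ideal generated by the
two monomials `x ^ e`, `x ^ m`, as soon as this holds for monomials. -/
theorem exists_eq_add_of_monomial_mul_eq {S : AddSubmonoid (ℕ × ℕ)} {e m w : ℕ × ℕ}
    (hS : ∀ s ∈ S, (∃ r ∈ S, s + w = e + r) → (∃ r ∈ S, s = e + r) ∨ ∃ r ∈ S, s = m + r)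
    {g h : MvPolynomial (Fin 2) k} (hg : g ∈ semigroupRing k S) (hh : h ∈ semigroupRing k S)
    (hgh : tuMonomial k w.1 w.2 * g = tuMonomial k e.1 e.2 * h) :
    ∃ f₁ ∈ semigroupRing k S, ∃ f₂ ∈ semigroupRing k S,
      g = tuMonomial k e.1 e.2 * f₁ + tuMonomial k m.1 m.2 * f₂ := by
  -- Each term of `g` is treated separately; partial sums over subsets of the support make this an
  -- induction.
  suffices H : ∀ T ⊆ g.support, ∃ f₁ ∈ semigroupRing k S, ∃ f₂ ∈ semigroupRing k S,
      ∑ d ∈ T, monomial d (coeff d g) =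
        tuMonomial k e.1 e.2 * f₁ + tuMonomial k m.1 m.2 * f₂ by
    have := H g.support subset_rfl
    rwa [support_sum_monomial_coeff] at this
  intro T
  classical
  induction T using Finset.induction_on with
  | empty => exact fun _ => ⟨0, zero_mem _, 0, zero_mem _, by simp⟩
  | insert d T hd ih =>
    intro hT
    obtain ⟨f₁, hf₁, f₂, hf₂, hf⟩ := ih ((Finset.subset_insert _ _).trans hT)
    have hdg : d ∈ g.support := hT (Finset.mem_insert_self _ _)
    -- Comparing coefficients at `w + d` shows that `w + d - e` is an exponent of `h`, hence lies in
    -- `S`; this is the premise of `hS`.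
    have hcoeff := congrArg
      (coeff (Finsupp.single 0 w.1 + Finsupp.single 1 w.2 + d)) hgh
    rw [tuMonomial_eq_monomial, coeff_monomial_mul, one_mul, coeff_tuMonomial_mul] at hcoeff
    have hne := mem_support_iff.1 hdg
    rw [hcoeff] at hne
    split_ifs at hne with hle
    · have hr := mem_of_mem_support_of_mem_semigroupRing hh _ (mem_support_iff.2 hne)
      simp at hr hle
      have hd' := hS _ (mem_of_mem_support_of_mem_semigroupRing hg d hdg)
        ⟨_, hr, by ext <;> simp <;> omega⟩
      rw [Finset.sum_insert hd, hf, monomial_eq_C_mul_tuMonomial]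
      have hC : C (coeff d g) ∈ semigroupRing k S :=
        (semigroupRing k S).algebraMap_mem (coeff d g)
      rcases hd' with ⟨r, hrS, hr⟩ | ⟨r, hrS, hr⟩
      · refine ⟨C (coeff d g) * tuMonomial k r.1 r.2 + f₁,
          add_mem (mul_mem hC (tuMonomial_mem_semigroupRing hrS)) hf₁, f₂, hf₂, ?_⟩
        obtain ⟨h0, h1⟩ := Prod.ext_iff.1 hr
        simp only [Prod.fst_add, Prod.snd_add] at h0 h1
        rw [h0, h1, ← tuMonomial_mul]; ring
      · refine ⟨f₁, hf₁, C (coeff d g) * tuMonomial k r.1 r.2 + f₂,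
          add_mem (mul_mem hC (tuMonomial_mem_semigroupRing hrS)) hf₂, ?_⟩
        obtain ⟨h0, h1⟩ := Prod.ext_iff.1 hr
        simp only [Prod.fst_add, Prod.snd_add] at h0 h1
        rw [h0, h1, ← tuMonomial_mul]; ring
    · exact absurd rfl hne

theorem monDt_tuMonomial_succ (a b i j : ℕ) :
    monDt k a b (tuMonomial k (i + 1) j) = ((i : k) + 1) • tuMonomial k (a + i) (b + j) := by
  simp [monDt, tuMonomial, Derivation.leibniz, Derivation.leibniz_pow, pderiv_X,
    smul_eq_C_mul]
  ring

theorem monDu_tuMonomial_succ (a b i j : ℕ) :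
    monDu k a b (tuMonomial k i (j + 1)) = ((j : k) + 1) • tuMonomial k (a + i) (b + j) := by
  simp [monDu, tuMonomial, Derivation.leibniz, Derivation.leibniz_pow, pderiv_X,
    smul_eq_C_mul]
  ring

theorem monDt_tuMonomial_zero (a b j : ℕ) : monDt k a b (tuMonomial k 0 j) = 0 := by
  simp [monDt, tuMonomial, Derivation.leibniz_pow, pderiv_X]

theorem monDu_tuMonomial_zero (a b i : ℕ) : monDu k a b (tuMonomial k i 0) = 0 := by
  simp [monDu, tuMonomial, Derivation.leibniz_pow, pderiv_X]

end Monomials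

/-! ### The ring `k[X, Y, Z]` and the constraints on its derivations -/

section CurveRing

variable {k : Type*} [Field k]

theorem curveSemigroup_mem_fst (p n : ℕ) : (n, 0) ∈ curveSemigroup p n :=
  AddSubmonoid.subset_closure (by simp)

theorem curveSemigroup_mem_snd (p n : ℕ) : (0, n) ∈ curveSemigroup p n :=
  AddSubmonoid.subset_closure (by simp)

theorem curveSemigroup_mem_mid (p n : ℕ) : (p, n - p) ∈ curveSemigroup p n :=
  AddSubmonoid.subset_closure (by simp)

/-- The generator `t ^ n` of the ring of the curve semigroup. -/
noncomputable def curveX (k : Type*) [Field k] (p n : ℕ) : semigroupRing k (curveSemigroup p n) :=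
  ⟨tuMonomial k n 0, tuMonomial_mem_semigroupRing (curveSemigroup_mem_fst p n)⟩

/-- The generator `u ^ n` of the ring of the curve semigroup. -/
noncomputable def curveY (k : Type*) [Field k] (p n : ℕ) : semigroupRing k (curveSemigroup p n) :=
  ⟨tuMonomial k 0 n, tuMonomial_mem_semigroupRing (curveSemigroup_mem_snd p n)⟩

/-- The generator `t ^ p * u ^ (n - p)` of the ring of the curve semigroup. -/
noncomputable def curveZ (k : Type*) [Field k] (p n : ℕ) : semigroupRing k (curveSemigroup p n) :=
  ⟨tuMonomial k p (n - p), tuMonomial_mem_semigroupRing (curveSemigroup_mem_mid p n)⟩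

theorem semigroupRing_curveSemigroup_eq_adjoin (p n : ℕ) :
    semigroupRing k (curveSemigroup p n) =
      Algebra.adjoin k {tuMonomial k n 0, tuMonomial k 0 n, tuMonomial k p (n - p)} := by
  apply le_antisymm
  · refine Algebra.adjoin_le ?_
    rintro _ ⟨s, hs, rfl⟩
    obtain ⟨a, b, c, rfl⟩ := mem_curveSemigroup.1 hs
    have : tuMonomial k (b * p + c * n) (a * n + b * (n - p)) =
        tuMonomial k 0 n ^ a * tuMonomial k p (n - p) ^ b * tuMonomial k n 0 ^ c := by
      simp [tuMonomial_pow, tuMonomial_mul]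
    simp only [SetLike.mem_coe, this]
    refine mul_mem (mul_mem (pow_mem ?_ a) (pow_mem ?_ b)) (pow_mem ?_ c) <;>
      exact Algebra.subset_adjoin (by simp)
  · refine Algebra.adjoin_le ?_
    rintro _ (rfl | rfl | rfl)
    exacts [(curveX k p n).2, (curveY k p n).2, (curveZ k p n).2]

theorem derivation_mem_semigroupRing_curveSemigroup {p n : ℕ}
    (E : Derivation k (MvPolynomial (Fin 2) k) (MvPolynomial (Fin 2) k))
    (hX : E (curveX k p n) ∈ semigroupRing k (curveSemigroup p n))
    (hY : E (curveY k p n) ∈ semigroupRing k (curveSemigroup p n))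
    (hZ : E (curveZ k p n) ∈ semigroupRing k (curveSemigroup p n))
    {f : MvPolynomial (Fin 2) k} (hf : f ∈ semigroupRing k (curveSemigroup p n)) :
    E f ∈ semigroupRing k (curveSemigroup p n) := by
  have hf' := hf
  rw [semigroupRing_curveSemigroup_eq_adjoin] at hf'
  induction hf' using Algebra.adjoin_induction with
  | mem x hx => rcases hx with rfl | rfl | rfl <;> assumption
  | algebraMap r => simp
  | add x y hx hy hx' hy' =>
    rw [← semigroupRing_curveSemigroup_eq_adjoin] at hx hy
    rw [map_add]; exact add_mem (hx' hx) (hy' hy)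
  | mul x y hx hy hx' hy' =>
    rw [← semigroupRing_curveSemigroup_eq_adjoin] at hx hy
    rw [Derivation.leibniz]
    exact add_mem (mul_mem hx (hy' hy)) (mul_mem hy (hx' hx))

/-- The restriction of a derivation to a subalgebra which it maps into itself. -/
def Derivation.restrictSubalgebra {R B : Type*} [CommRing R] [CommRing B] [Algebra R B]
    (A : Subalgebra R B) (E : Derivation R B B) (h : ∀ f ∈ A, E f ∈ A) : Derivation R A A :=
  Derivation.mk' ((E : B →ₗ[R] B).restrict (p := A.toSubmodule) (q := A.toSubmodule) h) (by
    intro a b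
    apply Subtype.ext
    exact E.leibniz a b)

theorem curveSemigroup_derivation_ext {p n : ℕ}
    {D : Derivation k (semigroupRing k (curveSemigroup p n))
      (semigroupRing k (curveSemigroup p n))}
    (hX : D (curveX k p n) = 0) (hY : D (curveY k p n) = 0) (hZ : D (curveZ k p n) = 0) :
    D = 0 := by
  have key : ∀ f (_ : f ∈ Algebra.adjoin k
      {tuMonomial k n 0, tuMonomial k 0 n, tuMonomial k p (n - p)})
      (hf : f ∈ semigroupRing k (curveSemigroup p n)), D ⟨f, hf⟩ = 0 := by
    intro f hf
    induction hf using Algebra.adjoin_induction with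
    | mem x hx => rcases hx with rfl | rfl | rfl <;> intro _ <;> assumption
    | algebraMap r => exact fun hr => D.map_algebraMap r
    | add x y hx hy hx' hy' =>
      rw [← semigroupRing_curveSemigroup_eq_adjoin] at hx hy
      intro h
      have : (⟨x + y, h⟩ : semigroupRing k (curveSemigroup p n)) = ⟨x, hx⟩ + ⟨y, hy⟩ := rfl
      rw [this, map_add, hx', hy', add_zero]
    | mul x y hx hy hx' hy' =>
      rw [← semigroupRing_curveSemigroup_eq_adjoin] at hx hy
      intro h
      have : (⟨x * y, h⟩ : semigroupRing k (curveSemigroup p n)) = ⟨x, hx⟩ * ⟨y, hy⟩ := rfl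
      rw [this, D.leibniz, hx', hy', smul_zero, smul_zero, add_zero]
  refine Derivation.ext fun f => ?_
  have := key f (semigroupRing_curveSemigroup_eq_adjoin (k := k) p n ▸ f.2) f.2
  exact this

theorem curveX_ne_zero (p n : ℕ) : curveX k p n ≠ 0 :=
  fun h => tuMonomial_ne_zero (k := k) n 0 (congrArg Subtype.val h)

theorem curveY_ne_zero (p n : ℕ) : curveY k p n ≠ 0 :=
  fun h => tuMonomial_ne_zero (k := k) 0 n (congrArg Subtype.val h)

/-- The relation `n X Y dZ = Z (p Y dX + (n - p) X dY)` coming from `Z ^ n = X ^ p Y ^ (n - p)`. -/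
theorem curveSemigroup_derivation_relation {p n : ℕ} (hp : 0 < p) (hlt : p < n)
    (D : Derivation k (semigroupRing k (curveSemigroup p n))
      (semigroupRing k (curveSemigroup p n))) :
    (n : semigroupRing k (curveSemigroup p n)) *
        (curveX k p n * curveY k p n * D (curveZ k p n)) =
      curveZ k p n * (p * (curveY k p n * D (curveX k p n)) +
        (n - p : ℕ) * (curveX k p n * D (curveY k p n))) := by
  have hrel : curveZ k p n ^ n = curveX k p n ^ p * curveY k p n ^ (n - p) := by
    apply Subtype.ext
    simp [curveX, curveY, curveZ, tuMonomial_pow, tuMonomial_mul, mul_comm]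
  have hD := congrArg D hrel
  simp only [D.leibniz, D.leibniz_pow] at hD
  obtain ⟨P, rfl⟩ : ∃ P, p = P + 1 := ⟨p - 1, by omega⟩
  obtain ⟨Q, hQ⟩ : ∃ Q, n - (P + 1) = Q + 1 := ⟨n - (P + 1) - 1, by omega⟩
  obtain ⟨N, rfl⟩ : ∃ N, n = N + 1 := ⟨n - 1, by omega⟩
  rw [hQ] at hD hrel ⊢
  -- Multiply the differentiated relation by `Z`, replace `Z^n` by `X^p Y^(n-p)`, and cancel this
  -- monomial.
  have hne : curveX k (P + 1) (N + 1) ^ P * curveY k (P + 1) (N + 1) ^ Q ≠ 0 :=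
    mul_ne_zero (pow_ne_zero _ (curveX_ne_zero _ _)) (pow_ne_zero _ (curveY_ne_zero _ _))
  refine mul_left_cancel₀ hne ?_
  simp only [smul_eq_mul, nsmul_eq_mul, Nat.add_sub_cancel] at hD
  linear_combination curveZ k (P + 1) (N + 1) * hD -
    ((N + 1 : ℕ) : semigroupRing k (curveSemigroup (P + 1) (N + 1))) *
      D (curveZ k (P + 1) (N + 1)) * hrel

theorem curveSemigroup_derivation_eq_zero [CharZero k] {p n : ℕ} (hp : 0 < p) (hlt : p < n)
    {D : Derivation k (semigroupRing k (curveSemigroup p n))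
      (semigroupRing k (curveSemigroup p n))}
    (hX : D (curveX k p n) = 0) (hY : D (curveY k p n) = 0) : D = 0 := by
  have : CharZero (semigroupRing k (curveSemigroup p n)) :=
    charZero_of_injective_algebraMap (algebraMap k _).injective
  refine curveSemigroup_derivation_ext hX hY ?_
  have h := curveSemigroup_derivation_relation hp hlt D
  rw [hX, hY] at h
  simpa [curveX_ne_zero, curveY_ne_zero, (hp.trans hlt).ne'] using h

end CurveRing

/-! ### Values of derivations on `X` and `Y`, and the explicit generators -/

section CurveRing

variable {k : Type*} [Field k]

/-- In monomials: an exponent using the generator `(n, 0)` is divisible by `X`. Otherwise it comes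
from `Y^a Z^b`, and the first coordinates of `hsr` read `(b + 1) p = b' p + (c' + 1) n`; by
coprimality `b ≥ n - 1`, so `Z^(n-1)` divides it. -/
theorem exists_eq_curveX_mul_add {p n : ℕ} (hcop : Nat.Coprime p n)
    {g h : semigroupRing k (curveSemigroup p n)}
    (hgh : curveZ k p n * curveY k p n * g = curveX k p n * h) :
    ∃ f₁ f₂, g = curveX k p n * f₁ + curveZ k p n ^ (n - 1) * f₂ := by
  have hS : ∀ s ∈ curveSemigroup p n,
      (∃ r ∈ curveSemigroup p n, s + (p, n - p + n) = (n, 0) + r) →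
      (∃ r ∈ curveSemigroup p n, s = (n, 0) + r) ∨
        ∃ r ∈ curveSemigroup p n, s = ((n - 1) * p, (n - 1) * (n - p)) + r := by
    rintro s hs ⟨r, hr, hsr⟩
    obtain ⟨a, b, c, rfl⟩ := mem_curveSemigroup.1 hs
    obtain ⟨a', b', c', rfl⟩ := mem_curveSemigroup.1 hr
    rcases c with _ | c
    · right
      rcases Nat.lt_or_ge (b + 1) n with hb | hb
      · refine absurd ?_ (mul_ne_mul_add_succ_mul (b := b') (c := c') hcop hb)
        have := congrArg Prod.fst hsr
        simp only [Prod.fst_add] at this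
        linarith
      · obtain ⟨d, rfl⟩ := Nat.exists_eq_add_of_le (show n - 1 ≤ b by omega)
        exact ⟨_, mem_curveSemigroup.2 ⟨a, d, 0, rfl⟩, by ext <;> simp <;> ring⟩
    · exact Or.inl ⟨_, mem_curveSemigroup.2 ⟨a, b, c, rfl⟩, by ext <;> simp; ring⟩
  obtain ⟨f₁, h₁, f₂, h₂, hf⟩ := exists_eq_add_of_monomial_mul_eq hS g.2 h.2 (by
    have := congrArg Subtype.val hgh
    simpa [curveX, curveY, curveZ, tuMonomial_mul] using this)
  refine ⟨⟨f₁, h₁⟩, ⟨f₂, h₂⟩, Subtype.ext ?_⟩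
  simpa [curveX, curveZ, tuMonomial_pow] using hf

theorem exists_eq_curveY_mul_add {p n : ℕ} (hcop : Nat.Coprime (n - p) n)
    {g h : semigroupRing k (curveSemigroup p n)}
    (hgh : curveZ k p n * curveX k p n * g = curveY k p n * h) :
    ∃ f₁ f₂, g = curveY k p n * f₁ + curveZ k p n ^ (n - 1) * f₂ := by
  have hS : ∀ s ∈ curveSemigroup p n,
      (∃ r ∈ curveSemigroup p n, s + (p + n, n - p) = (0, n) + r) →
      (∃ r ∈ curveSemigroup p n, s = (0, n) + r) ∨
        ∃ r ∈ curveSemigroup p n, s = ((n - 1) * p, (n - 1) * (n - p)) + r := by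
    rintro s hs ⟨r, hr, hsr⟩
    obtain ⟨a, b, c, rfl⟩ := mem_curveSemigroup.1 hs
    obtain ⟨a', b', c', rfl⟩ := mem_curveSemigroup.1 hr
    rcases a with _ | a
    · right
      rcases Nat.lt_or_ge (b + 1) n with hb | hb
      · refine absurd ?_ (mul_ne_mul_add_succ_mul (b := b') (c := a') hcop hb)
        have := congrArg Prod.snd hsr
        simp only [Prod.snd_add] at this
        linarith
      · obtain ⟨d, rfl⟩ := Nat.exists_eq_add_of_le (show n - 1 ≤ b by omega)
        exact ⟨_, mem_curveSemigroup.2 ⟨0, d, c, rfl⟩, by ext <;> simp <;> ring⟩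
    · exact Or.inl ⟨_, mem_curveSemigroup.2 ⟨a, b, c, rfl⟩, by ext <;> simp; ring⟩
  obtain ⟨f₁, h₁, f₂, h₂, hf⟩ := exists_eq_add_of_monomial_mul_eq hS g.2 h.2 (by
    have := congrArg Subtype.val hgh
    simpa [curveX, curveY, curveZ, tuMonomial_mul] using this)
  refine ⟨⟨f₁, h₁⟩, ⟨f₂, h₂⟩, Subtype.ext ?_⟩
  simpa [curveY, curveZ, tuMonomial_pow] using hf

/-- The coefficient at `X` isolates the constant term of `f₁`, since `Z^(n-1)` involves `u`. At
`Z^(n-1)` one gets the constant term of `f₂` plus a coefficient of `f₁` at the exponent of `Z^(n-1)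
/ X`, which is zero because that exponent is not in `S`. -/
theorem constantCoeff_eq_zero_of_curveX_relation {p n : ℕ} (hlt : p < n) (hn : 1 < n)
    (hcop : Nat.Coprime p n) {f₁ f₂ : semigroupRing k (curveSemigroup p n)}
    (h : f₁ * curveX k p n + f₂ * curveZ k p n ^ (n - 1) = 0) :
    constantCoeff (f₁ : MvPolynomial (Fin 2) k) = 0 ∧
      constantCoeff (f₂ : MvPolynomial (Fin 2) k) = 0 := by
  have h' : tuMonomial k n 0 * (f₁ : MvPolynomial (Fin 2) k) +
      tuMonomial k ((n - 1) * p) ((n - 1) * (n - p)) * f₂ = 0 := by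
    have := congrArg Subtype.val h
    simpa [curveX, curveZ, tuMonomial_pow, mul_comm] using this
  have hpos : 0 < (n - 1) * (n - p) := Nat.mul_pos (by omega) (by omega)
  constructor
  · have := congrArg (coeff (Finsupp.single 0 n + Finsupp.single 1 0)) h'
    rw [coeff_add, coeff_tuMonomial_mul, coeff_tuMonomial_mul, if_pos (by simp),
      if_neg (by simp; omega), tsub_self] at this
    simpa [constantCoeff_eq] using this
  · have := congrArg (coeff (Finsupp.single 0 ((n - 1) * p) +
      Finsupp.single 1 ((n - 1) * (n - p)))) h'
    rw [coeff_add, coeff_tuMonomial_mul, coeff_tuMonomial_mul, if_pos (by simp :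
      (n - 1) * p ≤ _ ∧ (n - 1) * (n - p) ≤ _), tsub_self] at this
    rw [constantCoeff_eq]
    refine (add_eq_right.2 ?_ : _ + coeff 0 (f₂ : MvPolynomial (Fin 2) k) = _).symm.trans this
    split_ifs with hle
    · by_contra hne
      have hm := mem_of_mem_support_of_mem_semigroupRing f₁.2 _ (mem_support_iff.2 hne)
      obtain ⟨a, b, c, habc⟩ := mem_curveSemigroup.1 hm
      simp at habc hle
      refine mul_ne_mul_add_succ_mul (B := n - 1) (b := b) (c := c) hcop (by omega) ?_
      have := habc.1
      rw [add_mul]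
      omega
    · rfl

theorem constantCoeff_eq_zero_of_curveY_relation {p n : ℕ} (hp : 0 < p) (hn : 1 < n)
    (hcop : Nat.Coprime (n - p) n) {f₁ f₂ : semigroupRing k (curveSemigroup p n)}
    (h : f₁ * curveY k p n + f₂ * curveZ k p n ^ (n - 1) = 0) :
    constantCoeff (f₁ : MvPolynomial (Fin 2) k) = 0 ∧
      constantCoeff (f₂ : MvPolynomial (Fin 2) k) = 0 := by
  have h' : tuMonomial k 0 n * (f₁ : MvPolynomial (Fin 2) k) +
      tuMonomial k ((n - 1) * p) ((n - 1) * (n - p)) * f₂ = 0 := by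
    have := congrArg Subtype.val h
    simpa [curveY, curveZ, tuMonomial_pow, mul_comm] using this
  have hpos : 0 < (n - 1) * p := Nat.mul_pos (by omega) (by omega)
  constructor
  · have := congrArg (coeff (Finsupp.single 0 0 + Finsupp.single 1 n)) h'
    rw [coeff_add, coeff_tuMonomial_mul, coeff_tuMonomial_mul, if_pos (by simp),
      if_neg (by simp; omega), tsub_self] at this
    simpa [constantCoeff_eq] using this
  · have := congrArg (coeff (Finsupp.single 0 ((n - 1) * p) +
      Finsupp.single 1 ((n - 1) * (n - p)))) h'
    rw [coeff_add, coeff_tuMonomial_mul, coeff_tuMonomial_mul, if_pos (by simp :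
      (n - 1) * p ≤ _ ∧ (n - 1) * (n - p) ≤ _), tsub_self] at this
    rw [constantCoeff_eq]
    refine (add_eq_right.2 ?_ : _ + coeff 0 (f₂ : MvPolynomial (Fin 2) k) = _).symm.trans this
    split_ifs with hle
    · by_contra hne
      have hm := mem_of_mem_support_of_mem_semigroupRing f₁.2 _ (mem_support_iff.2 hne)
      obtain ⟨a, b, c, habc⟩ := mem_curveSemigroup.1 hm
      simp at habc hle
      refine mul_ne_mul_add_succ_mul (B := n - 1) (b := b) (c := a) hcop (by omega) ?_
      have := habc.2
      rw [add_mul]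
      omega
    · rfl

/-- Solves the derivation relation for `Z Y U`, exhibiting it as a multiple of `X`; characteristic
zero allows division by `p`. -/
theorem mul_eq_mul_inv_smul_of_relation [CharZero k] {A : Type*} [CommRing A] [Algebra k A]
    {n p q : ℕ} {X Y Z U V W : A} (hp : p ≠ 0)
    (h : (n : A) * (X * Y * W) = Z * (p * (Y * U) + q * (X * V))) :
    Z * Y * U = X * ((p : k)⁻¹ • (n * (Y * W) - q * (Z * V))) := by
  have hp' : (p : k) ≠ 0 := Nat.cast_ne_zero.2 hp
  rw [mul_smul_comm, eq_inv_smul_iff₀ hp', Nat.cast_smul_eq_nsmul, nsmul_eq_mul]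
  linear_combination -h

/-- A criterion for four derivations which rescale two elements `X`, `Y` or send one of them to a
multiple of `W` to minimally generate the module of derivations. -/
theorem derMinimallyGenerates_of_apply {A : Type*} [CommRing A] [Algebra k A] (ε : A →+* k)
    {X Y W : A} {D : Fin 4 → Derivation k A A} {c : k} (hc : c ≠ 0)
    (hX : ∀ i, D i X = ![c • X, c • W, 0, 0] i) (hY : ∀ i, D i Y = ![0, 0, c • Y, c • W] i)
    (hdet : ∀ F : Derivation k A A, F X = 0 → F Y = 0 → F = 0)
    (hgenX : ∀ F : Derivation k A A, ∃ f₁ f₂, F X = X * f₁ + W * f₂)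
    (hgenY : ∀ F : Derivation k A A, ∃ f₁ f₂, F Y = Y * f₁ + W * f₂)
    (hrelX : ∀ f₁ f₂, f₁ * X + f₂ * W = 0 → ε f₁ = 0 ∧ ε f₂ = 0)
    (hrelY : ∀ f₁ f₂, f₁ * Y + f₂ * W = 0 → ε f₁ = 0 ∧ ε f₂ = 0) :
    DerMinimallyGenerates k A D := by
  have hDX : ∀ f : Fin 4 → A, (∑ i, f i • D i) X = c • (f 0 * X + f 1 * W) := by
    intro f
    simp [Fin.sum_univ_four, hX, Derivation.add_apply, Derivation.smul_apply, smul_add]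
  have hDY : ∀ f : Fin 4 → A, (∑ i, f i • D i) Y = c • (f 2 * Y + f 3 * W) := by
    intro f
    simp [Fin.sum_univ_four, hY, Derivation.add_apply, Derivation.smul_apply, smul_add]
  refine isMinimalGeneratingFamily_of_augmentation D ε ?_ ?_
  · rw [eq_top_iff]
    intro F _
    rw [Submodule.mem_span_range_iff_exists_fun]
    obtain ⟨f₁, f₂, h₁₂⟩ := hgenX F
    obtain ⟨f₃, f₄, h₃₄⟩ := hgenY F
    refine ⟨![c⁻¹ • f₁, c⁻¹ • f₂, c⁻¹ • f₃, c⁻¹ • f₄], ?_⟩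
    rw [← sub_eq_zero]
    apply hdet
    · rw [Derivation.sub_apply, hDX, h₁₂]
      simp [smul_smul, hc, mul_comm]
    · rw [Derivation.sub_apply, hDY, h₃₄]
      simp [smul_smul, hc, mul_comm]
  · intro f hf
    have h₁ := hDX f
    have h₂ := hDY f
    rw [hf, Derivation.zero_apply, eq_comm, smul_eq_zero_iff_right hc] at h₁ h₂
    obtain ⟨h0, h1⟩ := hrelX _ _ h₁
    obtain ⟨h2, h3⟩ := hrelY _ _ h₂
    intro i
    fin_cases i
    exacts [h0, h1, h2, h3]

theorem curveSemigroup_derivation_apply_curveX [CharZero k] {p n : ℕ} (hp : 0 < p) (hlt : p < n)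
    (hcop : Nat.Coprime p n)
    (F : Derivation k (semigroupRing k (curveSemigroup p n))
      (semigroupRing k (curveSemigroup p n))) :
    ∃ f₁ f₂, F (curveX k p n) = curveX k p n * f₁ + curveZ k p n ^ (n - 1) * f₂ := by
  have hF := curveSemigroup_derivation_relation hp hlt F
  exact exists_eq_curveX_mul_add hcop (mul_eq_mul_inv_smul_of_relation (k := k) hp.ne' hF)

theorem curveSemigroup_derivation_apply_curveY [CharZero k] {p n : ℕ} (hp : 0 < p) (hlt : p < n)
    (hcop : Nat.Coprime (n - p) n)
    (F : Derivation k (semigroupRing k (curveSemigroup p n))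
      (semigroupRing k (curveSemigroup p n))) :
    ∃ f₁ f₂, F (curveY k p n) = curveY k p n * f₁ + curveZ k p n ^ (n - 1) * f₂ := by
  have hF := curveSemigroup_derivation_relation hp hlt F
  rw [mul_comm (curveX k p n) (curveY k p n), add_comm] at hF
  exact exists_eq_curveY_mul_add hcop
    (mul_eq_mul_inv_smul_of_relation (k := k) (Nat.sub_pos_of_lt hlt).ne' hF)

theorem monDt_tuMonomial (a b : ℕ) {i : ℕ} (j : ℕ) (hi : 0 < i) :
    monDt k a b (tuMonomial k i j) = (i : k) • tuMonomial k (a + i - 1) (b + j) := by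
  obtain ⟨i, rfl⟩ : ∃ i', i = i' + 1 := ⟨i - 1, by omega⟩
  rw [monDt_tuMonomial_succ]; push_cast; rfl

theorem monDu_tuMonomial (a b i : ℕ) {j : ℕ} (hj : 0 < j) :
    monDu k a b (tuMonomial k i j) = (j : k) • tuMonomial k (a + i) (b + j - 1) := by
  obtain ⟨j, rfl⟩ : ∃ j', j = j' + 1 := ⟨j - 1, by omega⟩
  rw [monDu_tuMonomial_succ]; push_cast; rfl

/-- The generators of the module of derivations of the ring of the curve semigroup, with exponents
given uniformly in `p` and `n`. -/
noncomputable def curveDerivation (k : Type*) [Field k] (p n : ℕ) :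
    Fin 4 → Derivation k (MvPolynomial (Fin 2) k) (MvPolynomial (Fin 2) k) :=
  ![monDt k 1 0,
    monDt k (p * (n - 1) + 1 - n) ((n - 1) * (n - p)),
    monDu k 0 1,
    monDu k (p * (n - 1)) ((n - 1) * (n - p) + 1 - n)]

theorem curveDerivation_curveX {p n : ℕ} (hp : 0 < p) (hlt : p < n) (i : Fin 4) :
    curveDerivation k p n i (curveX k p n) =
      ![(n : k) • (curveX k p n : MvPolynomial (Fin 2) k),
        (n : k) • (curveZ k p n : MvPolynomial (Fin 2) k) ^ (n - 1), 0, 0] i := by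
  -- Ensures that the truncated subtraction in the `t`-exponent is the true one.
  have hle₁ : n ≤ p * (n - 1) + 1 := by
    have := Nat.mul_le_mul_right (n - 1) (show 1 ≤ p from hp); omega
  fin_cases i
  · simp [curveDerivation, curveX, monDt_tuMonomial _ _ _ (hp.trans hlt)]
  · simp only [curveDerivation, curveX, curveZ, tuMonomial_pow, Fin.mk_one, Matrix.cons_val_one,
      Matrix.cons_val_zero, monDt_tuMonomial _ _ _ (hp.trans hlt)]
    rw [Nat.sub_add_cancel hle₁, mul_comm p]; rfl
  · simp [curveDerivation, curveX, monDu_tuMonomial_zero]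
  · simp [curveDerivation, curveX, monDu_tuMonomial_zero]

theorem curveDerivation_curveY {p n : ℕ} (hp : 0 < p) (hlt : p < n) (i : Fin 4) :
    curveDerivation k p n i (curveY k p n) =
      ![0, 0, (n : k) • (curveY k p n : MvPolynomial (Fin 2) k),
        (n : k) • (curveZ k p n : MvPolynomial (Fin 2) k) ^ (n - 1)] i := by
  have hle₂ : n ≤ (n - 1) * (n - p) + 1 := by
    have := Nat.mul_le_mul_left (n - 1) (show 1 ≤ n - p by omega); omega
  fin_cases i
  · simp [curveDerivation, curveY, monDt_tuMonomial_zero]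
  · simp [curveDerivation, curveY, monDt_tuMonomial_zero]
  · simp [curveDerivation, curveY, monDu_tuMonomial _ _ _ (hp.trans hlt)]
  · simp only [curveDerivation, curveY, curveZ, tuMonomial_pow, Fin.reduceFinMk, Matrix.cons_val,
      monDu_tuMonomial _ _ _ (hp.trans hlt)]
    rw [Nat.sub_add_cancel hle₂, mul_comm p]; rfl

/-- Serves to show that `k[S]` is stable. The second derivation is `Z^(n-1) / X` times `t ∂/∂t`, so
it sends `Z` to `p Z^n / X = p X^(p-1) Y^(n-p)`; the fourth is analogous with `Y`. -/
theorem curveDerivation_curveZ {p n : ℕ} (hp : 0 < p) (hlt : p < n) (i : Fin 4) :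
    curveDerivation k p n i (curveZ k p n) =
      ![(p : k) • (curveZ k p n : MvPolynomial (Fin 2) k),
        (p : k) • ((curveX k p n : MvPolynomial (Fin 2) k) ^ (p - 1) *
          (curveY k p n : MvPolynomial (Fin 2) k) ^ (n - p)),
        ((n - p : ℕ) : k) • (curveZ k p n : MvPolynomial (Fin 2) k),
        ((n - p : ℕ) : k) • ((curveX k p n : MvPolynomial (Fin 2) k) ^ p *
          (curveY k p n : MvPolynomial (Fin 2) k) ^ (n - p - 1))] i := by
  have hle₁ : n ≤ p * (n - 1) + 1 := by
    have := Nat.mul_le_mul_right (n - 1) (show 1 ≤ p from hp); omega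
  have hle₂ : n ≤ (n - 1) * (n - p) + 1 := by
    have := Nat.mul_le_mul_left (n - 1) (show 1 ≤ n - p by omega); omega
  have hle₃ : n ≤ p * n := Nat.le_mul_of_pos_left n hp
  have hle₄ : n ≤ (n - p) * n := Nat.le_mul_of_pos_left n (by omega)
  have hq : 0 < n - p := by omega
  fin_cases i
  · simp [curveDerivation, curveZ, monDt_tuMonomial _ _ _ hp]
  · simp only [curveDerivation, curveX, curveY, curveZ, tuMonomial_pow, tuMonomial_mul, Fin.mk_one,
      Matrix.cons_val_one, Matrix.cons_val_zero, monDt_tuMonomial _ _ _ hp]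
    congr 2
    · have : p * (n - 1) + p = p * n := by
        rw [← Nat.mul_add_one, Nat.sub_add_cancel (hp.trans hlt)]
      rw [Nat.sub_one_mul]; omega
    · rw [← Nat.add_one_mul, Nat.sub_add_cancel (hp.trans hlt)]; ring
  · simp [curveDerivation, curveZ, monDu_tuMonomial _ _ _ hq]
  · simp only [curveDerivation, curveX, curveY, curveZ, tuMonomial_pow, tuMonomial_mul,
      Fin.reduceFinMk, Matrix.cons_val, monDu_tuMonomial _ _ _ hq]
    congr 2
    · rw [← Nat.mul_add_one, Nat.sub_add_cancel (hp.trans hlt)]; ring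
    · have : (n - 1) * (n - p) + (n - p) = (n - p) * n := by
        rw [← Nat.add_one_mul, Nat.sub_add_cancel (hp.trans hlt), mul_comm]
      rw [Nat.sub_one_mul (n - p)]; omega

theorem curveDerivation_mem {p n : ℕ} (hp : 0 < p) (hlt : p < n) (i : Fin 4)
    (f : MvPolynomial (Fin 2) k) (hf : f ∈ semigroupRing k (curveSemigroup p n)) :
    curveDerivation k p n i f ∈ semigroupRing k (curveSemigroup p n) := by
  have hXm := (curveX k p n).2
  have hYm := (curveY k p n).2
  have hZm := (curveZ k p n).2
  refine derivation_mem_semigroupRing_curveSemigroup (curveDerivation k p n i) ?_ ?_ ?_ hf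
  · rw [curveDerivation_curveX hp hlt]
    fin_cases i
    exacts [Subalgebra.smul_mem _ hXm _, Subalgebra.smul_mem _ (pow_mem hZm _) _,
      zero_mem _, zero_mem _]
  · rw [curveDerivation_curveY hp hlt]
    fin_cases i
    exacts [zero_mem _, zero_mem _, Subalgebra.smul_mem _ hYm _,
      Subalgebra.smul_mem _ (pow_mem hZm _) _]
  · rw [curveDerivation_curveZ hp hlt]
    fin_cases i
    exacts [Subalgebra.smul_mem _ hZm _,
      Subalgebra.smul_mem _ (mul_mem (pow_mem hXm _) (pow_mem hYm _)) _,
      Subalgebra.smul_mem _ hZm _,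
      Subalgebra.smul_mem _ (mul_mem (pow_mem hXm _) (pow_mem hYm _)) _]

theorem derMinimallyGeneratedBy_curveDerivation [CharZero k] {p n : ℕ} (hp : 0 < p) (hlt : p < n)
    (hcop : Nat.Coprime p n) :
    DerMinimallyGeneratedBy (semigroupRing k (curveSemigroup p n)) (curveDerivation k p n) := by
  have hcop' : Nat.Coprime (n - p) n := (Nat.coprime_self_sub_left hlt.le).2 hcop
  have hn : (n : k) ≠ 0 := Nat.cast_ne_zero.2 (hp.trans hlt).ne'
  refine ⟨fun i => Derivation.restrictSubalgebra _ (curveDerivation k p n i)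
    (curveDerivation_mem hp hlt i), fun i f => rfl,
    derMinimallyGenerates_of_apply (X := curveX k p n) (Y := curveY k p n)
      (W := curveZ k p n ^ (n - 1))
      ((constantCoeff : MvPolynomial (Fin 2) k →+* k).comp
        (semigroupRing k (curveSemigroup p n)).val.toRingHom) hn ?_ ?_
      (fun F => curveSemigroup_derivation_eq_zero hp hlt)
      (curveSemigroup_derivation_apply_curveX hp hlt hcop)
      (curveSemigroup_derivation_apply_curveY hp hlt hcop')
      (fun _ _ => constantCoeff_eq_zero_of_curveX_relation hlt (by omega) hcop)
      (fun _ _ => constantCoeff_eq_zero_of_curveY_relation hp (by omega) hcop')⟩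
  · intro i
    apply Subtype.ext
    refine (curveDerivation_curveX hp hlt i).trans ?_
    fin_cases i <;> rfl
  · intro i
    apply Subtype.ext
    refine (curveDerivation_curveY hp hlt i).trans ?_
    fin_cases i <;> rfl

end CurveRing

/-! ### The four cases -/

theorem eq_one_of_firstProjection_eq_top {p n : ℕ} (hlt : p < n) (hp : 0 < p)
    (h : firstProjection (curveSemigroup p n) = ⊤) : p = 1 := by
  obtain ⟨s, hs, h1⟩ := (h ▸ AddSubmonoid.mem_top 1 : 1 ∈ firstProjection (curveSemigroup p n))
  obtain ⟨a, b, c, rfl⟩ := mem_curveSemigroup.1 hs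
  change b * p + c * n = 1 at h1
  -- A nonzero `c` would contribute at least `n ≥ 2` to a sum equal to `1`.
  have hc : c = 0 := by
    by_contra hc
    have := Nat.le_mul_of_pos_left n (Nat.pos_of_ne_zero hc)
    omega
  subst hc
  rw [zero_mul, add_zero] at h1
  exact Nat.eq_one_of_mul_eq_one_left h1

theorem sub_eq_one_of_secondProjection_eq_top {p n : ℕ} (hlt : p < n) (hp : 0 < p)
    (h : secondProjection (curveSemigroup p n) = ⊤) : n - p = 1 := by
  obtain ⟨s, hs, h1⟩ := (h ▸ AddSubmonoid.mem_top 1 : 1 ∈ secondProjection (curveSemigroup p n))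
  obtain ⟨a, b, c, rfl⟩ := mem_curveSemigroup.1 hs
  change a * n + b * (n - p) = 1 at h1
  have hc : a = 0 := by
    by_contra hc
    have := Nat.le_mul_of_pos_left n (Nat.pos_of_ne_zero hc)
    omega
  subst hc
  rw [zero_mul, zero_add] at h1
  exact Nat.eq_one_of_mul_eq_one_left h1

theorem proposition3p1 (k : Type*) [Field k] [CharZero k] (n₀ n₁ : ℕ)
    (hpos : 0 < n₀) (hlt : n₀ < n₁) (hcop : Nat.gcd n₀ n₁ = 1) :
    (firstProjection (curveSemigroup n₀ n₁) ≠ ⊤ → secondProjection (curveSemigroup n₀ n₁) ≠ ⊤ →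
      DerMinimallyGeneratedBy (semigroupRing k (curveSemigroup n₀ n₁))
        ![monDt k 1 0,
          monDt k (n₀ * (n₁ - 1) + 1 - n₁) ((n₁ - 1) * (n₁ - n₀)),
          monDu k 0 1,
          monDu k (n₀ * (n₁ - 1)) ((n₁ - 1) * (n₁ - n₀) + 1 - n₁)]) ∧
    (firstProjection (curveSemigroup n₀ n₁) = ⊤ → secondProjection (curveSemigroup n₀ n₁) ≠ ⊤ →
      DerMinimallyGeneratedBy (semigroupRing k (curveSemigroup n₀ n₁))
        ![monDt k 1 0,
          monDt k 0 (1 + (n₁ - 2) * n₁),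
          monDu k 0 1,
          monDu k (n₁ - 1) ((n₁ - 1) * (n₁ - 2))]) ∧
    (firstProjection (curveSemigroup n₀ n₁) ≠ ⊤ → secondProjection (curveSemigroup n₀ n₁) = ⊤ →
      DerMinimallyGeneratedBy (semigroupRing k (curveSemigroup n₀ n₁))
        ![monDt k 1 0,
          monDt k (n₀ * (n₁ - 1) + 1 - n₁) (n₁ - 1),
          monDu k 0 1,
          monDu k (n₀ * (n₁ - 1)) 0]) ∧
    (firstProjection (curveSemigroup n₀ n₁) = ⊤ → secondProjection (curveSemigroup n₀ n₁) = ⊤ →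
      DerMinimallyGeneratedBy (semigroupRing k (curveSemigroup n₀ n₁))
        ![monDt k 1 0, monDt k 0 1, monDu k 0 1, monDu k 1 0]) := by
  have main := derMinimallyGeneratedBy_curveDerivation (k := k) hpos hlt hcop
  rw [curveDerivation] at main
  refine ⟨fun _ _ => main, fun h₁ _ => ?_, fun _ h₂ => ?_, fun h₁ h₂ => ?_⟩
  · obtain rfl := eq_one_of_firstProjection_eq_top hlt hpos h₁
    -- Writing `n₁ = m + 2` removes the truncated subtractions before the exponents are compared.
    obtain ⟨m, rfl⟩ := Nat.exists_eq_add_of_le' (show 2 ≤ n₁ by omega)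
    convert main using 6
    · simp
    · simp only [Nat.add_sub_cancel, show m + 2 - 1 = m + 1 by omega]; ring
    · simp
    · simp only [Nat.add_sub_cancel, show m + 2 - 1 = m + 1 by omega]
      rw [show (m + 1) * (m + 1) + 1 = (m + 1) * m + (m + 2) by ring, Nat.add_sub_cancel]
  · have hq := sub_eq_one_of_secondProjection_eq_top hlt hpos h₂
    rw [hq] at main
    convert main using 6
    · simp
    · omega
  · obtain rfl := eq_one_of_firstProjection_eq_top hlt hpos h₁
    have hq := sub_eq_one_of_secondProjection_eq_top hlt hpos h₂
    obtain rfl : n₁ = 2 := by omega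
    exact main
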